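/- **Theorem 1.1.** Let $t$ be a positive integer. For a partition $\lambda=(\lambda_1\ge\lambda_2\ge\cdots)$ (with $\lambda_i=0$ beyond its length) let $|\lambda|$ be its size, $h(\square)$ the hook length of a cell $\square$ of its diagram, and $\mathcal H(\lambda)$ the multiset of all its hook lengths; $\lambda$ is a $t$-core if no element of $\mathcal H(\lambda)$ is divisible by $t$. Put $t_0=0$ if $t$ is odd, $t_0=1/2$ if $t$ is even, and $\mathbb Z'=t_0+\mathbb Z$. A $V_t$-coding is a vector $(v_0,v_1,\dots,v_{t-1})\in(\mathbb Z')^t$ such that (i) the set of residues $\{v_i \bmod t: 0\le i\le t-1\}$ equals $t_0+\{0,1,\dots,t-1\}$; (ii) $v_0+v_1+\cdots+v_{t-1}=0$; (iii) $v_0>v_1>\cdots>v_{t-1}$. For each $t$-core $\lambda$, let $\phi_t(\lambda)=(v_0,\dots,v_{t-1})$ be the list, in decreasing order, of those elements of $W(\lambda)=\{\lambda_i-i+\tfrac{t+1}{2}: i\ge 1\}$ that are the largest element of $W(\lambda)$ in their congruence class modulo $t$. Then $\phi_t$ is a well-defined bijection from the set of $t$-cores onto the set of $V_t$-codings. For every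 $t$-core $\lambda$, with $\phi_t(\lambda)=(v_0,\dots,v_{t-1})$, $$|\lambda|=\frac1{2t}\left(v_0^2+v_1^2+\cdots+v_{t-1}^2\right)-\frac{t^2-1}{24},$$ and, for every field $F$ and every function $\tau:\mathbb Z\to F$ such that $\tau(h)\ne0$ for all $h\in\mathcal H(\lambda)$ and $\tau(i)\neq 0$ for $1\le i\le t-1$ (so that both sides are defined), $$\prod_{h\in\mathcal H(\lambda)}\frac{\tau(h-t)\,\tau(h+t)}{\tau(h)^2}=\prod_{i=1}^{t-1}\frac{\tau(-i)^{\beta_i(\lambda)}}{\tau(i)^{\beta_i(\lambda)+t-i}}\ \prod_{0\le i<j\le t-1}\tau(v_i-v_j),$$ where $\beta_i(\lambda)=\#\{\square\in\lambda: h(\square)=t-i\}$. -/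

import Mathlib

namespace HookCoding

/-! Partitions are Mathlib's Young diagrams: `μ.rowLen i` is the part `λ_{i+1}` (zero beyond the
length), `μ.colLen j` is the part of the conjugate partition, `μ.card` is the size `|λ|`. -/

/-- The hook length of the cell `(i, j)` (row `i`, column `j`, counted from `0`):
arm length + leg length + 1. -/
def hookLength (μ : YoungDiagram) (c : ℕ × ℕ) : ℕ :=
  (μ.rowLen c.1 - (c.2 + 1)) + (μ.colLen c.2 - (c.1 + 1)) + 1

/-- The multiset `H(λ)` of all hook lengths of `λ`. -/
def hookMultiset (μ : YoungDiagram) : Multiset ℕ :=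
  μ.cells.val.map (hookLength μ)

/-- The multiset `H_t(λ)` of the hook lengths divisible by `t`. -/
def hookMultisetMod (t : ℕ) (μ : YoungDiagram) : Multiset ℕ :=
  (hookMultiset μ).filter (fun h => t ∣ h)

/-- `λ` is a `t`-core when no hook length is divisible by `t`. -/
def IsCore (t : ℕ) (μ : YoungDiagram) : Prop :=
  hookMultisetMod t μ = 0

/-- `β_i(λ)`, the number of cells of `λ` with hook length `t - i` (used for `1 ≤ i < t`). -/
def beta (t : ℕ) (μ : YoungDiagram) (i : ℕ) : ℕ :=
  (μ.cells.filter (fun c => hookLength μ c = t - i)).card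

/-- The offset `t₀`: `0` for odd `t`, `1/2` for even `t`. -/
def offset (t : ℕ) : ℚ := if Odd t then 0 else 1 / 2

/-- The set `ℤ' = t₀ + ℤ` of integers (`t` odd) or of proper half-integers (`t` even). -/
def halfInts (t : ℕ) : Set ℚ := {x | ∃ k : ℤ, x = offset t + k}

/-- `V_t`-codings. The fields `residue_mem` and `residue_surj` together say that the set of the
residue classes mod `t` of the entries equals that of `t₀ + {0, 1, …, t - 1}`. -/
structure IsVCoding (t : ℕ) (v : Fin t → ℚ) : Prop where
  mem : ∀ i, v i ∈ halfInts t
  residue_mem : ∀ i, ∃ r : ℕ, r < t ∧ v i ≡ offset t + r [PMOD (t : ℚ)]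
  residue_surj : ∀ r : ℕ, r < t → ∃ i, v i ≡ offset t + r [PMOD (t : ℚ)]
  sum_eq_zero : ∑ i, v i = 0
  strictAnti : StrictAnti v

/-- The difference `v_i - v_j` as an integer; see `cast_diff`. -/
def diff {t : ℕ} (v : Fin t → ℚ) (i j : Fin t) : ℤ := ⌊v i - v j⌋

/-- For a `V_t`-coding, `diff v i j` is exactly `v_i - v_j`. -/
theorem cast_diff {t : ℕ} {v : Fin t → ℚ} (hv : IsVCoding t v) (i j : Fin t) :
    (diff v i j : ℚ) = v i - v j := by
  obtain ⟨k, hk⟩ := hv.mem i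
  obtain ⟨l, hl⟩ := hv.mem j
  have h : v i - v j = ((k - l : ℤ) : ℚ) := by
    rw [hk, hl]; push_cast; ring
  rw [diff, h, Int.floor_intCast]

/-- The `W`-set of `λ`: all numbers `λ_i - i + (t+1)/2` with `i ≥ 1`. -/
def WSet (t : ℕ) (μ : YoungDiagram) : Set ℚ :=
  {x | ∃ i : ℕ, x = (μ.rowLen i : ℚ) - ((i : ℚ) + 1) + ((t : ℚ) + 1) / 2}

/-- The `t`-maximal elements of `X`: those that are the largest in their class mod `t`. -/
def tMax (t : ℕ) (X : Set ℚ) : Set ℚ :=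
  {x | x ∈ X ∧ ∀ y ∈ X, y ≡ x [PMOD (t : ℚ)] → y ≤ x}

/-- The `V`-set of `λ`. -/
def VSet (t : ℕ) (μ : YoungDiagram) : Set ℚ := tMax t (WSet t μ)

end HookCoding

/-!
The proof replaces a partition by its bead set `B = {λ_i - i : i ≥ 1}`, a set of integers that
contains all small integers and no large one (a Maya set). The complement of `B` is read off from
the columns, and the cell in row `i` and column `j` corresponds to the pair of a bead `b` and a free
position `c < b`, with hook length `b - c` (`card_hookLength_eq`). Hence the number of hooks of
length `h` is the gap number `N(h) = #{x ∈ B : x - h ∉ B}` (`gaps`), and the partition is a `t`-core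
exactly when `x ∈ B` implies `x - t ∈ B` (`isCore_iff`). Such a set is determined by its largest
elements in the `t` classes modulo `t`, its top elements (`IsMaya.mem_iff_top`). The `V`-set is the
set of top elements shifted by `(t + 1) / 2`.

A Maya set is the bead set of a partition exactly when its charge is `0` (`charge_beads`,
`exists_beads_eq`), and for a set with `x ∈ B → x - t ∈ B` the charge is read off from the sum of the
top elements (`IsMaya.sum_top`): charge `0` is the condition that the entries of the coding have sum
`0`. This gives the bijection.

Let `δ` be the indicator function of the top elements, so `δ x = 1_B x - 1_B (x + t)`. Expanding the
autocorrelation of `δ` shows that the number of pairs of top elements at distance `h` is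
`N(h + t) + N(h - t) - 2 N(h)` for all integers `h` (`IsMaya.ncard_top_pairs`). Together with
`N(-h) = N(h) + h` and `N(t) = 0` this is an identity between multisets of integers
(`hooks_identity`). Taking the product of the values of `τ` over both sides gives the product
formula (`prod_hooks`), and taking the sum of the squares gives the size formula (`card_mul`).
-/

namespace HookCoding

/-! ### Maya sets, their charge and their gap numbers -/

/-- A set of integers is a Maya set when it contains all sufficiently small integers and no
sufficiently large one. -/
def IsMaya (B : Set ℤ) : Prop := ∃ L : ℕ, (∀ x < -(L : ℤ), x ∈ B) ∧ ∀ x ∈ B, x < L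

/-- The integer valued indicator function of a set of integers. -/
noncomputable def occ (B : Set ℤ) (x : ℤ) : ℤ := B.indicator 1 x

theorem occ_of_mem {B : Set ℤ} {x : ℤ} (h : x ∈ B) : occ B x = 1 := by simp [occ, h]

theorem occ_of_notMem {B : Set ℤ} {x : ℤ} (h : x ∉ B) : occ B x = 0 := by simp [occ, h]

theorem IsMaya.exists_occ {B : Set ℤ} (hB : IsMaya B) :
    ∃ L : ℕ, (∀ x < -(L : ℤ), occ B x = 1) ∧ ∀ x : ℤ, L ≤ x → occ B x = 0 := by
  obtain ⟨L, h1, h2⟩ := hB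
  exact ⟨L, fun x hx => occ_of_mem (h1 x hx),
    fun x hx => occ_of_notMem fun h => absurd (h2 x h) (not_lt.2 hx)⟩

theorem isMaya_Iio : IsMaya (Set.Iio 0) :=
  ⟨0, fun x hx => by simpa using hx, fun x hx => by simpa using hx⟩

theorem hasFiniteSupport_of_window {f : ℤ → ℤ} (L : ℕ)
    (h : ∀ x : ℤ, x < -(L : ℤ) ∨ (L : ℤ) ≤ x → f x = 0) : f.HasFiniteSupport := by
  refine (Set.finite_Ico (-(L : ℤ)) L).subset fun x hx => ?_
  by_contra hc
  refine hx (h x ?_)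
  rw [Set.mem_Ico] at hc
  omega

theorem finsum_comp_add (f : ℤ → ℤ) (a : ℤ) : ∑ᶠ x, f (x + a) = ∑ᶠ x, f x :=
  finsum_comp_equiv (Equiv.addRight a) (f := f)

theorem finsum_occ {S : Set ℤ} (hS : S.Finite) (g : ℤ → ℤ) :
    ∑ᶠ x, g x * occ S x = ∑ x ∈ hS.toFinset, g x := by
  rw [finsum_eq_sum_of_support_subset (s := hS.toFinset)]
  · refine Finset.sum_congr rfl fun x hx => ?_
    rw [occ_of_mem (by simpa using hx), mul_one]
  · intro x hx
    by_contra hc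
    exact hx (by simp only [occ_of_notMem (fun h => hc (by simpa using h)), mul_zero])

theorem finsum_occ_eq_ncard {S : Set ℤ} (hS : S.Finite) : ∑ᶠ x, occ S x = S.ncard := by
  have := finsum_occ hS 1
  simpa [Set.ncard_eq_toFinset_card S hS] using this

/-- The charge of a Maya set: the number of its nonnegative elements minus the number of negative
integers outside it. -/
noncomputable def charge (B : Set ℤ) : ℤ := ∑ᶠ x, (occ B x - occ (Set.Iio 0) x)

theorem IsMaya.hasFiniteSupport_sub {B : Set ℤ} (hB : IsMaya B) (g : ℤ → ℤ) (a : ℤ) :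
    (fun x => g x * (occ B (x + a) - occ (Set.Iio 0) (x + a))).HasFiniteSupport := by
  obtain ⟨L, h1, h2⟩ := hB.exists_occ
  obtain ⟨K, h3, h4⟩ := isMaya_Iio.exists_occ
  refine hasFiniteSupport_of_window (L + K + a.natAbs) fun x hx => ?_
  rcases hx with hx | hx
  · simp [h1 (x + a) (by omega), h3 (x + a) (by omega)]
  · simp [h2 (x + a) (by omega), h4 (x + a) (by omega)]

theorem IsMaya.hasFiniteSupport_step {B : Set ℤ} (hB : IsMaya B) (g : ℤ → ℤ) (a : ℤ) :
    (fun x => g x * (occ B x - occ B (x + a))).HasFiniteSupport := by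
  obtain ⟨L, h1, h2⟩ := hB.exists_occ
  refine hasFiniteSupport_of_window (L + a.natAbs) fun x hx => ?_
  rcases hx with hx | hx
  · simp [h1 (x + a) (by omega), h1 x (by omega)]
  · simp [h2 (x + a) (by omega), h2 x (by omega)]

theorem finsum_step_Iio (g : ℤ → ℤ) (t : ℕ) :
    ∑ᶠ x, g x * (occ (Set.Iio 0) x - occ (Set.Iio 0) (x + t)) =
      ∑ i ∈ Finset.range t, g (-(i + 1 : ℤ)) := by
  rw [finsum_eq_sum_of_support_subset (s := (Finset.range t).image fun i : ℕ => -(i + 1 : ℤ))]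
  · rw [Finset.sum_image (fun a _ b _ h => by simpa using h)]
    refine Finset.sum_congr rfl fun i hi => ?_
    have hi := Finset.mem_range.1 hi
    rw [occ_of_mem (by simp; omega), occ_of_notMem (by simp; omega)]
    ring
  · intro x hx
    by_contra hc
    refine hx ?_
    rcases lt_or_ge x (-t) with h | h
    · simp only [occ_of_mem (show x ∈ Set.Iio (0 : ℤ) by simp; omega),
        occ_of_mem (show x + t ∈ Set.Iio (0 : ℤ) by simp; omega), sub_self, mul_zero]
    · have h0 : 0 ≤ x := by
        by_contra h'
        refine hc ?_
        simp only [Finset.coe_image, Set.mem_image, Finset.coe_range, Set.mem_Iio]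
        exact ⟨(-x - 1).toNat, by omega, by omega⟩
      simp only [occ_of_notMem (show x ∉ Set.Iio (0 : ℤ) by simp; omega),
        occ_of_notMem (show x + t ∉ Set.Iio (0 : ℤ) by simp; omega), sub_self, mul_zero]

/-- Sums weighted by the steps `occ B x - occ B (x + t)`, by comparison with the negative integers:
the difference of the two indicator functions has finite support, so its shift by `t` can be moved
onto the weight `g`. -/
theorem IsMaya.finsum_step {B : Set ℤ} (hB : IsMaya B) (g : ℤ → ℤ) (t : ℕ) :
    ∑ᶠ x, g x * (occ B x - occ B (x + t)) =
      ∑ᶠ x, (g x - g (x - t)) * (occ B x - occ (Set.Iio 0) x) +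
        ∑ i ∈ Finset.range t, g (-(i + 1 : ℤ)) := by
  have e : ∀ x, g x * (occ B x - occ B (x + t)) =
      (g x * (occ B (x + 0) - occ (Set.Iio 0) (x + 0)) -
        g x * (occ B (x + t) - occ (Set.Iio 0) (x + t))) +
      g x * (occ (Set.Iio 0) x - occ (Set.Iio 0) (x + t)) := fun x => by rw [add_zero]; ring
  have e2 : ∑ᶠ x, g x * (occ B (x + t) - occ (Set.Iio 0) (x + t)) =
      ∑ᶠ x, g (x - t) * (occ B x - occ (Set.Iio 0) x) := by
    rw [← finsum_comp_add (fun x => g (x - t) * (occ B x - occ (Set.Iio 0) x)) t]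
    simp only [add_sub_cancel_right]
  have s0 := hB.hasFiniteSupport_sub g 0
  have s1 := hB.hasFiniteSupport_sub g t
  have s2 := hB.hasFiniteSupport_sub (fun x => g (x - t)) 0
  rw [finsum_congr e, finsum_add_distrib (s0.fun_sub s1) (isMaya_Iio.hasFiniteSupport_step g t),
    finsum_step_Iio, finsum_sub_distrib s0 s1, e2]
  simp only [add_zero] at s0 s2 ⊢
  rw [← finsum_sub_distrib s0 s2]
  simp only [sub_mul]

theorem IsMaya.finsum_step_one {B : Set ℤ} (hB : IsMaya B) (t : ℕ) :
    ∑ᶠ x, (occ B x - occ B (x + t)) = t := by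
  have := hB.finsum_step 1 t
  simpa using this

theorem IsMaya.finsum_step_id {B : Set ℤ} (hB : IsMaya B) (t : ℕ) :
    2 * ∑ᶠ x, x * (occ B x - occ B (x + t)) = 2 * (t * charge B) - t * (t + 1) := by
  have h := hB.finsum_step id t
  have h2 : ∀ n : ℕ, 2 * ∑ i ∈ Finset.range n, (-(i + 1 : ℤ)) = -(n * (n + 1)) := by
    intro n
    induction n with
    | zero => simp
    | succ n ih => rw [Finset.sum_range_succ, mul_add, ih]; push_cast; ring
  simp only [id, sub_sub_cancel] at h
  rw [h, mul_add, h2, ← mul_finsum, charge]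
  ring

/-- The number of ways to move an element of `B` down by `h` onto a free position. All integers `h`
are allowed; for a Maya set this number is finite also when `h ≤ 0`. -/
noncomputable def gaps (B : Set ℤ) (h : ℤ) : ℕ := {x | x ∈ B ∧ x - h ∉ B}.ncard

theorem IsMaya.finite_gaps {B : Set ℤ} (hB : IsMaya B) (h : ℤ) :
    {x | x ∈ B ∧ x - h ∉ B}.Finite := by
  obtain ⟨L, h1, h2⟩ := hB
  refine (Set.finite_Ico (-(L : ℤ) + h) L).subset fun x hx => ⟨?_, h2 x hx.1⟩
  by_contra hc
  exact hx.2 (h1 _ (by omega))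

theorem occ_gaps (B : Set ℤ) (h x : ℤ) :
    occ {x | x ∈ B ∧ x - h ∉ B} x = occ B x * (1 - occ B (x - h)) := by
  by_cases h1 : x ∈ B <;> by_cases h2 : x - h ∈ B <;> simp [occ, h1, h2]

theorem IsMaya.hasFiniteSupport_gaps {B : Set ℤ} (hB : IsMaya B) (a b : ℤ) :
    (fun x => occ B (x + a) * (1 - occ B (x + b))).HasFiniteSupport := by
  obtain ⟨L, h1, h2⟩ := hB.exists_occ
  refine hasFiniteSupport_of_window (L + a.natAbs + b.natAbs) fun x hx => ?_
  rcases hx with hx | hx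
  · simp [h1 (x + b) (by omega)]
  · simp [h2 (x + a) (by omega)]

theorem IsMaya.finsum_gaps {B : Set ℤ} (hB : IsMaya B) (a b : ℤ) :
    ∑ᶠ x, occ B (x + a) * (1 - occ B (x + b)) = gaps B (a - b) := by
  rw [gaps, ← finsum_occ_eq_ncard (hB.finite_gaps _), finsum_congr (occ_gaps B (a - b)),
    ← finsum_comp_add (fun x => occ B x * (1 - occ B (x - (a - b)))) a]
  simp only [show ∀ x, x + a - (a - b) = x + b from fun x => by ring]

theorem gaps_zero (B : Set ℤ) : gaps B 0 = 0 := by simp [gaps]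

/-- Moves up by `h` outnumber moves down by `h` by `∑ (occ B x - occ B (x + h)) = h`. -/
theorem IsMaya.gaps_neg {B : Set ℤ} (hB : IsMaya B) (h : ℕ) : gaps B (-h) = gaps B h + h := by
  have e := hB.finsum_step_one h
  have e1 := hB.finsum_gaps 0 h
  have e2 := hB.finsum_gaps h 0
  have e3 := finsum_sub_distrib (hB.hasFiniteSupport_gaps 0 h) (hB.hasFiniteSupport_gaps h 0)
  rw [e1, e2, finsum_congr (g := fun x => occ B x - occ B (x + h))
    (fun x => by rw [add_zero]; ring), e] at e3
  simp only [zero_sub, sub_zero] at e3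
  omega

/-- The second difference (with step `t`) of the gap numbers is the autocorrelation of
`x ↦ occ B x - occ B (x + t)`. -/
theorem IsMaya.finsum_step_mul_step {B : Set ℤ} (hB : IsMaya B) (t h : ℤ) :
    ∑ᶠ x, (occ B x - occ B (x + t)) * (occ B (x - h) - occ B (x - h + t)) =
      gaps B (h + t) + gaps B (h - t) - 2 * gaps B h := by
  have s := hB.hasFiniteSupport_gaps
  have e : ∀ x, (occ B x - occ B (x + t)) * (occ B (x - h) - occ B (x - h + t)) =
      (occ B (x + 0) * (1 - occ B (x + (t - h))) + occ B (x + t) * (1 - occ B (x + -h))) -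
      (occ B (x + 0) * (1 - occ B (x + -h)) + occ B (x + t) * (1 - occ B (x + (t - h)))) := by
    intro x
    rw [add_zero, show x + (t - h) = x - h + t by ring, ← sub_eq_add_neg]
    ring
  rw [finsum_congr e, finsum_sub_distrib ((s _ _).fun_add (s _ _)) ((s _ _).fun_add (s _ _)),
    finsum_add_distrib (s _ _) (s _ _), finsum_add_distrib (s _ _) (s _ _)]
  simp only [hB.finsum_gaps]
  rw [show 0 - (t - h) = h - t by ring, show t - -h = h + t by ring, show 0 - -h = h by ring,
    show t - (t - h) = h by ring]
  ring

/-! ### Flush sets and their top elements -/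

/-- A set of integers is `t`-flush when no element can be moved down by `t` onto a free position;
this is the condition on the bead set that corresponds to `t`-cores. -/
def IsFlush (t : ℕ) (B : Set ℤ) : Prop := ∀ x ∈ B, x - t ∈ B

/-- The elements of `B` that can be moved up by `t`. For a `t`-flush set they are the largest
elements in the classes modulo `t`. -/
def top (t : ℕ) (B : Set ℤ) : Set ℤ := {x | x ∈ B ∧ x + t ∉ B}

theorem IsFlush.mem_of_dvd {t : ℕ} {B : Set ℤ} (h : IsFlush t B) {x y : ℤ} (hx : x ∈ B)
    (hyx : y ≤ x) (hd : (t : ℤ) ∣ x - y) : y ∈ B := by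
  have key : ∀ k : ℕ, x - t * k ∈ B := by
    intro k
    induction k with
    | zero => simpa using hx
    | succ k ih =>
      have := h _ ih
      rwa [show x - t * ((k + 1 : ℕ) : ℤ) = x - t * k - t by push_cast; ring]
  obtain ⟨c, hc⟩ := hd
  rcases Nat.eq_zero_or_pos t with rfl | ht
  · rwa [show y = x by simp at hc; omega]
  · have hc0 : 0 ≤ c := by
      by_contra hneg
      have : (t : ℤ) * c < 0 := mul_neg_of_pos_of_neg (by omega) (by omega)
      omega
    have := key c.toNat
    rwa [Int.toNat_of_nonneg hc0, ← hc, sub_sub_cancel] at this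

theorem IsFlush.gaps_eq_zero {t : ℕ} {B : Set ℤ} (h : IsFlush t B) : gaps B t = 0 := by
  have : {x | x ∈ B ∧ x - t ∉ B} = ∅ :=
    Set.eq_empty_of_forall_notMem fun x hx => hx.2 (h x hx.1)
  rw [gaps, this, Set.ncard_empty]

theorem IsFlush.occ_top {t : ℕ} {B : Set ℤ} (h : IsFlush t B) (x : ℤ) :
    occ (top t B) x = occ B x - occ B (x + t) := by
  have := h (x + t)
  rw [add_sub_cancel_right] at this
  by_cases h1 : x ∈ B <;> by_cases h2 : x + t ∈ B <;> simp [occ, top, h1, h2]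
  exact h1 (this h2)

theorem IsMaya.finite_top {B : Set ℤ} (hB : IsMaya B) (t : ℕ) : (top t B).Finite := by
  simpa [top] using hB.finite_gaps (-t)

theorem IsMaya.ncard_top {t : ℕ} {B : Set ℤ} (hB : IsMaya B) (h : IsFlush t B) :
    (top t B).ncard = t := by
  have := hB.finsum_step_one t
  simp only [← h.occ_top] at this
  rw [finsum_occ_eq_ncard (hB.finite_top t)] at this
  exact_mod_cast this

/-- The sum of the top elements depends on the charge and on `t` only. -/
theorem IsMaya.sum_top {t : ℕ} {B : Set ℤ} (hB : IsMaya B) (h : IsFlush t B) :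
    2 * ∑ x ∈ (hB.finite_top t).toFinset, x = 2 * (t * charge B) - t * (t + 1) := by
  have := hB.finsum_step_id t
  simp only [← h.occ_top] at this
  rwa [finsum_occ (hB.finite_top t)] at this

theorem IsFlush.top_le {t : ℕ} {B : Set ℤ} (h : IsFlush t B) {x y : ℤ} (hx : x ∈ top t B)
    (hy : y ∈ B) (hd : (t : ℤ) ∣ x - y) : y ≤ x := by
  by_contra hlt
  refine hx.2 (h.mem_of_dvd hy ?_ ?_)
  · obtain ⟨c, hc⟩ := hd
    have : c < 0 := by
      by_contra hc0
      have : 0 ≤ (t : ℤ) * c := mul_nonneg (by omega) (by omega)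
      omega
    nlinarith [(Nat.cast_nonneg t : (0 : ℤ) ≤ t)]
  · rw [show y - (x + t) = -(x - y) - t by ring]
    exact (dvd_neg.2 hd).sub (dvd_refl _)

theorem IsMaya.mem_iff_top {t : ℕ} (ht : 0 < t) {B : Set ℤ} (hB : IsMaya B) (h : IsFlush t B)
    (x : ℤ) : x ∈ B ↔ ∃ m ∈ top t B, x ≤ m ∧ (t : ℤ) ∣ m - x := by
  classical
  refine ⟨fun hx => ?_, fun ⟨m, hm, h1, h2⟩ => h.mem_of_dvd hm.1 h1 h2⟩
  obtain ⟨L, -, hL⟩ := hB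
  have hex : ∃ k : ℕ, x + t * k ∉ B := by
    refine ⟨(L - x).toNat, fun hm => ?_⟩
    have h1 := hL _ hm
    have h2 : ((L - x).toNat : ℤ) ≤ t * (L - x).toNat :=
      le_mul_of_one_le_left (by omega) (by omega)
    omega
  obtain ⟨k, hk⟩ : ∃ k, Nat.find hex = k + 1 := Nat.exists_eq_succ_of_ne_zero fun h0 => by
    have := Nat.find_spec hex
    rw [h0] at this
    simp [hx] at this
  refine ⟨x + t * k, ⟨not_not.1 (Nat.find_min hex (by omega)), ?_⟩, ?_, ?_⟩
  · have := Nat.find_spec hex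
    rw [hk] at this
    rwa [show x + t * k + t = x + t * ((k + 1 : ℕ) : ℤ) by push_cast; ring]
  · have : (0 : ℤ) ≤ t * k := by positivity
    omega
  · simp

/-- The pairs of elements of `top t B` at distance `h` are counted by the second difference of the
gap numbers. -/
theorem IsMaya.ncard_top_pairs {t : ℕ} {B : Set ℤ} (hB : IsMaya B) (h : IsFlush t B) (k : ℤ) :
    {x | x ∈ top t B ∧ x - k ∈ top t B}.ncard + 2 * gaps B k =
      gaps B (k + t) + gaps B (k - t) := by
  have e := hB.finsum_step_mul_step t k
  have : ∀ x, (occ B x - occ B (x + t)) * (occ B (x - k) - occ B (x - k + t)) =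
      occ {x | x ∈ top t B ∧ x - k ∈ top t B} x := by
    intro x
    rw [← h.occ_top, ← h.occ_top]
    by_cases h1 : x ∈ top t B <;> by_cases h2 : x - k ∈ top t B <;> simp [occ, h1, h2]
  rw [finsum_congr this, finsum_occ_eq_ncard ((hB.finite_top t).subset fun x hx => hx.1)] at e
  omega

/-- The set of all integers that lie below some `w i` in its class modulo `t`. -/
def below {t : ℕ} (w : Fin t → ℤ) : Set ℤ := {x | ∃ i, x ≤ w i ∧ (t : ℤ) ∣ w i - x}

theorem isFlush_below {t : ℕ} (w : Fin t → ℤ) : IsFlush t (below w) := by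
  rintro x ⟨i, h1, h2⟩
  exact ⟨i, by omega, by rw [sub_sub_eq_add_sub, add_sub_right_comm]; exact h2.add (dvd_refl _)⟩

theorem isMaya_below {t : ℕ} {w : Fin t → ℤ} (hw : ∀ x, ∃ i, (t : ℤ) ∣ w i - x) :
    IsMaya (below w) := by
  have hle : ∀ i, (w i).natAbs ≤ ∑ j, (w j).natAbs := fun i =>
    Finset.single_le_sum (f := fun j => (w j).natAbs) (fun _ _ => Nat.zero_le _) (Finset.mem_univ i)
  refine ⟨∑ j, (w j).natAbs + 1, fun x hx => ?_, ?_⟩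
  · obtain ⟨i, hi⟩ := hw x
    have := hle i
    exact ⟨i, by omega, hi⟩
  · rintro x ⟨i, hi, -⟩
    have := hle i
    omega

theorem top_below {t : ℕ} (ht : 0 < t) {w : Fin t → ℤ}
    (hw : ∀ i j, (t : ℤ) ∣ w i - w j → i = j) : top t (below w) = Set.range w := by
  ext x
  constructor
  · rintro ⟨⟨i, h1, h2⟩, h3⟩
    refine ⟨i, le_antisymm ?_ h1⟩
    by_contra hlt
    refine h3 ⟨i, ?_, by rw [← sub_sub]; exact h2.sub (dvd_refl _)⟩
    have := Int.le_of_dvd (by omega) h2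
    omega
  · rintro ⟨i, rfl⟩
    refine ⟨⟨i, le_rfl, by simp⟩, ?_⟩
    rintro ⟨j, h1, h2⟩
    have : j = i := hw j i (by
      have := h2.add (dvd_refl (t : ℤ))
      rwa [← sub_sub, sub_add_cancel] at this)
    subst this
    omega

/-- A system of `t` integers meets every class modulo `t` exactly when it meets none twice. -/
theorem residues_surj_iff_inj {t : ℕ} (ht : 0 < t) (w : Fin t → ℤ) :
    (∀ x, ∃ i, (t : ℤ) ∣ w i - x) ↔ ∀ i j, (t : ℤ) ∣ w i - w j → i = j := by
  have : NeZero t := ⟨ht.ne'⟩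
  have hb : Function.Surjective (fun i => (w i : ZMod t)) ↔
      Function.Injective (fun i => (w i : ZMod t)) :=
    (Finite.injective_iff_surjective_of_equiv
      (Fintype.equivOfCardEq (by simp [ZMod.card]))).symm
  have hd : ∀ a b : ℤ, (t : ℤ) ∣ a - b ↔ (a : ZMod t) = b := fun a b => by
    rw [ZMod.intCast_eq_intCast_iff_dvd_sub, ← dvd_neg, neg_sub]
  simp only [hd]
  refine Iff.trans ⟨fun h z => ?_, fun h x => h x⟩ hb
  obtain ⟨x, rfl⟩ := ZMod.intCast_surjective z
  exact h x

theorem exists_strictAnti_enum {α : Type*} [LinearOrder α] {S : Set α} (hS : S.Finite) {t : ℕ}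
    (hc : S.ncard = t) : ∃ w : Fin t → α, StrictAnti w ∧ Set.range w = S := by
  have hc' : hS.toFinset.card = t := by rw [← Set.ncard_eq_toFinset_card S hS, hc]
  refine ⟨fun i => hS.toFinset.orderEmbOfFin hc' i.rev, fun i j hij => ?_, ?_⟩
  · exact (hS.toFinset.orderEmbOfFin hc').strictMono (Fin.rev_lt_rev.2 hij)
  · have := Finset.range_orderEmbOfFin hS.toFinset hc'
    rw [hS.coe_toFinset] at this
    refine Eq.trans ?_ this
    exact Fin.revPerm.surjective.range_comp (hS.toFinset.orderEmbOfFin hc')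

/-! ### Young diagrams and their bead sets -/

/-- The bead set of a partition: the numbers `λ_i - i` for `i ≥ 1`. -/
def beads (μ : YoungDiagram) : Set ℤ := {x | ∃ i : ℕ, x = μ.rowLen i - (i + 1)}

theorem beads_eq_range (μ : YoungDiagram) :
    beads μ = Set.range fun i : ℕ => (μ.rowLen i : ℤ) - (i + 1) :=
  Set.ext fun _ => ⟨fun ⟨i, h⟩ => ⟨i, h.symm⟩, fun ⟨i, h⟩ => ⟨i, h.symm⟩⟩

theorem lt_rowLen_iff_lt_colLen {μ : YoungDiagram} {i j : ℕ} :
    j < μ.rowLen i ↔ i < μ.colLen j := by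
  rw [← YoungDiagram.mem_iff_lt_rowLen, YoungDiagram.mem_iff_lt_colLen]

theorem rowLen_eq_zero {μ : YoungDiagram} {i : ℕ} (h : μ.colLen 0 ≤ i) : μ.rowLen i = 0 := by
  by_contra h0
  exact absurd (lt_rowLen_iff_lt_colLen.1 (Nat.pos_of_ne_zero h0)) (not_lt.2 h)

theorem isMaya_beads (μ : YoungDiagram) : IsMaya (beads μ) := by
  refine ⟨μ.colLen 0 + μ.rowLen 0, fun x hx => ⟨(-x - 1).toNat, ?_⟩, ?_⟩
  · rw [rowLen_eq_zero (by omega)]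
    omega
  · rintro x ⟨i, rfl⟩
    have := μ.rowLen_anti 0 i (Nat.zero_le i)
    omega

theorem strictAnti_bead (μ : YoungDiagram) :
    StrictAnti fun i : ℕ => (μ.rowLen i : ℤ) - (i + 1) := fun i j hij => by
  have := μ.rowLen_anti i j hij.le
  dsimp only
  omega

/-- The positions free of beads are described by the columns. -/
theorem notMem_beads_iff {μ : YoungDiagram} {x : ℤ} :
    x ∉ beads μ ↔ ∃ j : ℕ, x = j - μ.colLen j := by
  classical
  constructor
  · intro hx
    have hex : ∃ i : ℕ, (μ.rowLen i : ℤ) - (i + 1) ≤ x := by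
      refine ⟨μ.colLen 0 + (-x).toNat, ?_⟩
      rw [rowLen_eq_zero (by omega)]
      omega
    -- the free position `x` lies in the column that meets exactly the rows with beads above `x`
    obtain ⟨i, hi⟩ : ∃ i, i = Nat.find hex := ⟨_, rfl⟩
    have h1 := Nat.find_spec hex
    rw [← hi] at h1
    have h1' : (μ.rowLen i : ℤ) - (i + 1) ≠ x := fun h => hx ⟨i, h.symm⟩
    refine ⟨(x + i).toNat, ?_⟩
    have hc : μ.colLen (x + i).toNat = i := by
      apply le_antisymm
      · by_contra hlt
        have := lt_rowLen_iff_lt_colLen.2 (not_le.1 hlt)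
        omega
      · rcases Nat.eq_zero_or_pos i with h0 | h0
        · omega
        · have h2 := Nat.find_min hex (m := i - 1) (by omega)
          have := (lt_rowLen_iff_lt_colLen (μ := μ) (i := i - 1) (j := (x + i).toNat)).1
            (by omega)
          omega
    rw [hc]
    omega
  · rintro ⟨j, rfl⟩ ⟨i, hi⟩
    have := lt_rowLen_iff_lt_colLen (μ := μ) (i := i) (j := j)
    omega

theorem hookLength_eq {μ : YoungDiagram} {c : ℕ × ℕ} (hc : c ∈ μ.cells) :
    (hookLength μ c : ℤ) = ((μ.rowLen c.1 : ℤ) - (c.1 + 1)) - (c.2 - μ.colLen c.2) := by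
  have h1 : c.2 < μ.rowLen c.1 := YoungDiagram.mem_iff_lt_rowLen.1 (YoungDiagram.mem_cells c |>.1 hc)
  have h2 := lt_rowLen_iff_lt_colLen.1 h1
  rw [hookLength]
  omega

/-- The cells with hook length `h` correspond to the beads with a free position `h` steps below:
the bead comes from the row, the free position from the column of the cell. -/
theorem card_hookLength_eq {μ : YoungDiagram} {h : ℕ} (hh : 0 < h) :
    (μ.cells.filter fun c => hookLength μ c = h).card = gaps (beads μ) h := by
  rw [gaps, ← Set.ncard_coe_finset]
  refine Set.ncard_congr (fun c _ => (μ.rowLen c.1 : ℤ) - (c.1 + 1)) ?_ ?_ ?_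
  · intro c hc
    simp only [Finset.coe_filter, Set.mem_ofPred_eq] at hc
    refine ⟨⟨c.1, rfl⟩, notMem_beads_iff.2 ⟨c.2, ?_⟩⟩
    rw [← hc.2, hookLength_eq hc.1]
    ring
  · rintro ⟨i, j⟩ ⟨k, l⟩ hc hd he
    simp only [Finset.coe_filter, Set.mem_ofPred_eq] at hc hd
    have h1 := hookLength_eq hc.1
    have h2 := hookLength_eq hd.1
    have e1 : i = k := (strictAnti_bead μ).injective he
    subst e1
    rw [hc.2] at h1
    rw [hd.2] at h2
    have h3 : (j : ℤ) - μ.colLen j = l - μ.colLen l := by simp only at h1 h2; omega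
    rcases lt_trichotomy j l with h | h | h
    · have := μ.colLen_anti j l h.le
      omega
    · rw [h]
    · have := μ.colLen_anti l j h.le
      omega
  · rintro x ⟨⟨i, rfl⟩, hx⟩
    obtain ⟨j, hj⟩ := notMem_beads_iff.1 hx
    have hm : (i, j) ∈ μ.cells := by
      rw [YoungDiagram.mem_cells, YoungDiagram.mem_iff_lt_rowLen]
      have := lt_rowLen_iff_lt_colLen (μ := μ) (i := i) (j := j)
      omega
    refine ⟨(i, j), ?_, rfl⟩
    simp only [Finset.coe_filter, Set.mem_ofPred_eq]
    refine ⟨hm, ?_⟩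
    have := hookLength_eq hm
    simp only at this
    omega

theorem beads_injective : Function.Injective beads := by
  intro μ ν h
  have hw : (fun i : ℕ => -((μ.rowLen i : ℤ) - (i + 1))) =
      fun i : ℕ => -((ν.rowLen i : ℤ) - (i + 1)) := by
    refine ((strictAnti_bead μ).neg.range_inj (strictAnti_bead ν).neg).1 ?_
    have e : ∀ κ : YoungDiagram, (Set.range fun i : ℕ => -((κ.rowLen i : ℤ) - (i + 1))) =
        Neg.neg '' beads κ := fun κ => by
      rw [beads_eq_range, ← Set.range_comp]
      rfl
    exact (e μ).trans ((congrArg _ h).trans (e ν).symm)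
  refine SetLike.ext fun ⟨i, j⟩ => ?_
  have := congrFun hw i
  rw [YoungDiagram.mem_iff_lt_rowLen, YoungDiagram.mem_iff_lt_rowLen]
  omega

/-- The charge of a Maya set as a count of its elements in a large window. -/
theorem charge_eq_card {B : Set ℤ} [DecidablePred (· ∈ B)] {n m : ℕ}
    (h1 : ∀ x < -(n : ℤ), x ∈ B) (h2 : ∀ x ∈ B, x < m) :
    charge B = ((Finset.Ico (-(n : ℤ)) m).filter (· ∈ B)).card - n := by
  rw [charge, finsum_eq_sum_of_support_subset (s := Finset.Ico (-(n : ℤ)) m)]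
  · rw [Finset.sum_sub_distrib]
    congr 1
    · simp [occ, Set.indicator_apply]
    · have : (Finset.Ico (-(n : ℤ)) m).filter (· ∈ Set.Iio 0) = Finset.Ico (-(n : ℤ)) 0 := by
        ext x
        simp only [Finset.mem_filter, Finset.mem_Ico, Set.mem_Iio]
        omega
      simp [occ, Set.indicator_apply, Finset.sum_boole]
  · intro x hx
    by_contra hc
    rw [Finset.coe_Ico, Set.mem_Ico, not_and_or, not_le, not_lt] at hc
    refine hx ?_
    rcases hc with hc | hc
    · simp only [occ_of_mem (h1 x hc), occ_of_mem (show x ∈ Set.Iio (0 : ℤ) by simp; omega),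
        sub_self]
    · simp only [occ_of_notMem (fun h => not_lt.2 hc (h2 x h)),
        occ_of_notMem (show x ∉ Set.Iio (0 : ℤ) by simp; omega), sub_self]

theorem charge_beads (μ : YoungDiagram) : charge (beads μ) = 0 := by
  classical
  have h1 : ∀ x < -(μ.colLen 0 : ℤ), x ∈ beads μ := fun x hx => ⟨(-x - 1).toNat, by
    rw [rowLen_eq_zero (by omega)]
    omega⟩
  have h2 : ∀ x ∈ beads μ, x < μ.rowLen 0 := by
    rintro x ⟨i, rfl⟩
    have := μ.rowLen_anti 0 i (Nat.zero_le i)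
    omega
  have h3 : (Finset.Ico (-(μ.colLen 0 : ℤ)) (μ.rowLen 0)).filter (· ∈ beads μ) =
      (Finset.range (μ.colLen 0)).image fun i : ℕ => (μ.rowLen i : ℤ) - (i + 1) := by
    ext x
    simp only [Finset.mem_filter, Finset.mem_Ico, Finset.mem_image, Finset.mem_range]
    constructor
    · rintro ⟨⟨h, -⟩, i, rfl⟩
      refine ⟨i, ?_, rfl⟩
      by_contra hc
      rw [rowLen_eq_zero (not_lt.1 hc)] at h
      omega
    · rintro ⟨i, hi, rfl⟩
      exact ⟨⟨by omega, h2 _ ⟨i, rfl⟩⟩, i, rfl⟩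
  rw [charge_eq_card h1 h2, h3, Finset.card_image_of_injective _ (strictAnti_bead μ).injective]
  simp

theorem exists_rowLen_eq {r : ℕ → ℕ} (hr : Antitone r) {n : ℕ} (hn : ∀ i, n ≤ i → r i = 0) :
    ∃ μ : YoungDiagram, ∀ i, μ.rowLen i = r i := by
  let μ : YoungDiagram :=
    { cells := (Finset.range n ×ˢ Finset.range (r 0)).filter fun c => c.2 < r c.1
      isLowerSet := by
        rintro ⟨i, j⟩ ⟨k, l⟩ ⟨h1, h2⟩ hm
        simp only [Finset.coe_filter, Finset.mem_product, Finset.mem_range, Set.mem_ofPred_eq]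
          at hm h1 h2 ⊢
        have := hr h1
        omega }
  have hμ : ∀ i j, (i, j) ∈ μ ↔ j < r i := by
    intro i j
    rw [← YoungDiagram.mem_cells]
    simp only [μ, Finset.mem_filter, Finset.mem_product, Finset.mem_range]
    have h0 := hr (Nat.zero_le i)
    have := hn i
    omega
  refine ⟨μ, fun i => ?_⟩
  have h1 := fun j => (YoungDiagram.mem_iff_lt_rowLen (μ := μ) (i := i) (j := j)).symm.trans (hμ i j)
  have h2 := h1 (r i)
  have h3 := h1 (μ.rowLen i)
  omega

/-- Every Maya set of charge `0` is the bead set of a partition. -/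
theorem exists_beads_eq {B : Set ℤ} (hB : IsMaya B) (hc : charge B = 0) :
    ∃ μ : YoungDiagram, beads μ = B := by
  classical
  obtain ⟨L, h1, h2⟩ := hB
  -- `p k` says that the position `k` steps below `L - 1` is occupied, so that `Nat.nth p`
  -- enumerates `B` in decreasing order
  let p : ℕ → Prop := fun k => (L : ℤ) - 1 - k ∈ B
  have hp : ∀ k, 2 * L ≤ k → p k := fun k hk => h1 _ (by omega)
  have hinf : (Set.ofPred p).Infinite := Set.infinite_of_not_bddAbove fun ⟨b, hb⟩ => by
    have := hb (show p (2 * L + b + 1) from hp _ (by omega))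
    omega
  -- charge `0` makes the enumeration reach `-(i + 1)` at index `i` for all `i ≥ L`
  have hcount : Nat.count p (2 * L) = L := by
    have e := charge_eq_card h1 h2
    rw [Nat.count_eq_card_filter_range]
    have : (Finset.Ico (-(L : ℤ)) L).filter (· ∈ B) =
        ((Finset.range (2 * L)).filter p).image fun k : ℕ => (L : ℤ) - 1 - k := by
      ext x
      simp only [Finset.mem_filter, Finset.mem_Ico, Finset.mem_image, Finset.mem_range, p]
      constructor
      · rintro ⟨h, hx⟩
        refine ⟨((L : ℤ) - 1 - x).toNat, ⟨by omega, ?_⟩, by omega⟩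
        rwa [show (L : ℤ) - 1 - ((L : ℤ) - 1 - x).toNat = x by omega]
      · rintro ⟨k, ⟨hk, hm⟩, rfl⟩
        exact ⟨by omega, hm⟩
    rw [this, Finset.card_image_of_injective _ (fun a b hab => by simpa using hab), hc] at e
    have e' := sub_eq_zero.1 e.symm
    exact_mod_cast e'
  have hcount' : ∀ i, Nat.count p (2 * L + i) = L + i := by
    intro i
    induction i with
    | zero => exact hcount
    | succ i ih => rw [← add_assoc, Nat.count_succ, ih, if_pos (hp _ (by omega))]; ring
  have hnth : ∀ i, Nat.nth p (L + i) = 2 * L + i := fun i => by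
    rw [← hcount' i, Nat.nth_count (hp _ (by omega))]
  have hmono := Nat.nth_strictMono hinf
  have hbound : ∀ i, Nat.nth p i ≤ L + i := by
    intro i
    have := hmono.add_le_nat L i
    have := hnth i
    omega
  obtain ⟨μ, hμ⟩ := exists_rowLen_eq (r := fun i => L + i - Nat.nth p i) (n := L)
    (antitone_nat_of_succ_le fun i => by
      have : Nat.nth p i < Nat.nth p (i + 1) := hmono (Nat.lt_succ_self i)
      omega)
    (fun i hi => by
      obtain ⟨k, rfl⟩ := Nat.exists_eq_add_of_le hi
      simp only [hnth]
      omega)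
  have hrow : ∀ i, (μ.rowLen i : ℤ) - (i + 1) = L - 1 - Nat.nth p i := fun i => by
    have := hbound i
    rw [hμ]
    omega
  refine ⟨μ, ?_⟩
  ext x
  constructor
  · rintro ⟨i, rfl⟩
    rw [hrow]
    exact Nat.nth_mem_of_infinite hinf i
  · intro hx
    have hlt := h2 x hx
    have hpx : p ((L : ℤ) - 1 - x).toNat := by
      simp only [p]
      rwa [show (L : ℤ) - 1 - ((L : ℤ) - 1 - x).toNat = x by omega]
    refine ⟨Nat.count p ((L : ℤ) - 1 - x).toNat, ?_⟩
    rw [hrow, Nat.nth_count hpx]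
    omega

/-! ### Hook lengths of a core -/

theorem isCore_iff {t : ℕ} (ht : 0 < t) (μ : YoungDiagram) :
    IsCore t μ ↔ IsFlush t (beads μ) := by
  rw [IsCore, hookMultisetMod, Multiset.filter_eq_nil]
  constructor
  · intro h x hx
    by_contra hc
    have h1 : gaps (beads μ) t ≠ 0 := by
      exact Set.ncard_ne_zero_of_mem (a := x) ⟨hx, hc⟩ ((isMaya_beads μ).finite_gaps t)
    rw [← card_hookLength_eq ht, Finset.card_ne_zero] at h1
    obtain ⟨c, hc⟩ := h1
    rw [Finset.mem_filter] at hc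
    exact h t (Multiset.mem_map.2 ⟨c, hc.1, hc.2⟩) (dvd_refl t)
  · intro h k hk hd
    obtain ⟨c, hc, rfl⟩ := Multiset.mem_map.1 hk
    have e := hookLength_eq (μ := μ) (c := c) hc
    refine notMem_beads_iff.2 ⟨c.2, rfl⟩ (h.mem_of_dvd ⟨c.1, rfl⟩ ?_ ?_)
    · omega
    · rw [← e]
      exact_mod_cast hd

theorem beta_eq {t i : ℕ} (hi : i < t) (μ : YoungDiagram) :
    beta t μ i = gaps (beads μ) ((t : ℤ) - i) := by
  rw [beta, card_hookLength_eq (by omega), Nat.cast_sub hi.le]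

/-- The hook lengths of a partition as a multiset of integers. -/
def hooks (μ : YoungDiagram) : Multiset ℤ := (hookMultiset μ).map (↑)

theorem count_hooks (μ : YoungDiagram) (k : ℤ) :
    (hooks μ).count k = if 0 < k then gaps (beads μ) k else 0 := by
  split_ifs with hk
  · obtain ⟨n, rfl⟩ := Int.eq_ofNat_of_zero_le hk.le
    rw [hooks, Multiset.count_map_eq_count' _ _ Nat.cast_injective,
      ← card_hookLength_eq (by omega), hookMultiset, Multiset.count_map, Finset.card_def,
      Finset.filter_val]
    simp only [eq_comm]
  · rw [Multiset.count_eq_zero]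
    intro hm
    simp only [hooks, hookMultiset, Multiset.mem_map] at hm
    obtain ⟨_, ⟨c, -, rfl⟩, rfl⟩ := hm
    rw [hookLength] at hk
    omega

/-- The multiset of the differences `w i - w j` with `i < j`. -/
def diffs {t : ℕ} (w : Fin t → ℤ) : Multiset ℤ := ∑ i, ∑ j ∈ Finset.Ioi i, {w i - w j}

theorem count_diffs {t : ℕ} {w : Fin t → ℤ} (hw : StrictAnti w) (k : ℤ) :
    (diffs w).count k =
      if 0 < k then {x | x ∈ Set.range w ∧ x - k ∈ Set.range w}.ncard else 0 := by
  classical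
  simp only [diffs, Multiset.count_sum', Multiset.count_singleton]
  split_ifs with hk
  · have h1 : ∀ i, (∑ j ∈ Finset.Ioi i, if k = w i - w j then 1 else 0) =
        if w i - k ∈ Set.range w then 1 else 0 := by
      intro i
      split_ifs with hi
      · obtain ⟨j, hj⟩ := hi
        rw [Finset.sum_eq_single_of_mem j]
        · rw [if_pos (by omega)]
        · exact Finset.mem_Ioi.2 (hw.lt_iff_gt.1 (by omega))
        · intro l _ hl
          rw [if_neg fun h => hl (hw.injective (by omega))]
      · exact Finset.sum_eq_zero fun j _ => if_neg fun h => hi ⟨j, by omega⟩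
    have h2 : {x | x ∈ Set.range w ∧ x - k ∈ Set.range w} =
        ((Finset.univ.filter fun i => w i - k ∈ Set.range w).image w : Finset ℤ) := by
      ext x
      simp only [Finset.coe_image, Finset.coe_filter, Finset.mem_univ, true_and, Set.mem_image,
        Set.mem_ofPred_eq]
      constructor
      · rintro ⟨⟨i, rfl⟩, h⟩
        exact ⟨i, h, rfl⟩
      · rintro ⟨i, h, rfl⟩
        exact ⟨⟨i, rfl⟩, h⟩
    rw [Finset.sum_congr rfl fun i _ => h1 i, h2, Set.ncard_coe_finset,
      Finset.card_image_of_injective _ hw.injective, Finset.card_filter]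
  · refine Finset.sum_eq_zero fun i _ => Finset.sum_eq_zero fun j hj => if_neg fun h => ?_
    have := hw (Finset.mem_Ioi.1 hj)
    omega

/-- The multiplicity of `k` in the multiset containing `e * i` exactly `c i` times for
`1 ≤ i < t`. The sign `e` is `1` or `-1`. -/
theorem count_sum_nsmul_singleton (c : ℕ → ℕ) (t : ℕ) (e : ℤ) (he : e ^ 2 = 1) (k : ℤ) :
    (∑ i ∈ Finset.Ico 1 t, c i • ({e * (i : ℤ)} : Multiset ℤ)).count k =
      if 0 < e * k ∧ e * k < t then c (e * k).toNat else 0 := by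
  have h : ∀ i : ℤ, k = e * i ↔ e * k = i := fun i =>
    ⟨fun h => by rw [h, ← mul_assoc, ← sq, he, one_mul],
      fun h => by rw [← h, ← mul_assoc, ← sq, he, one_mul]⟩
  simp only [Multiset.count_sum', Multiset.count_nsmul, Multiset.count_singleton, h]
  split_ifs with hk
  · rw [Finset.sum_eq_single_of_mem (e * k).toNat (Finset.mem_Ico.2 (by omega))]
    · rw [if_pos (by omega), mul_one]
    · intro i _ hi
      rw [if_neg (by omega), mul_zero]
  · refine Finset.sum_eq_zero fun i hi => ?_
    have := Finset.mem_Ico.1 hi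
    rw [if_neg (by omega), mul_zero]

/-- The multiset identity behind both the size formula and the product formula. For every `k` the
two sides have the same number of elements equal to `k`: this is the second difference identity for
the gap numbers, corrected for `|k| < t` because the hook lengths see positive gaps only. The factors `1` and `-1`
match the shape of `count_sum_nsmul_singleton`. -/
theorem hooks_identity {t : ℕ} {μ : YoungDiagram} (hμ : IsFlush t (beads μ))
    {w : Fin t → ℤ} (hw : StrictAnti w) (hr : Set.range w = top t (beads μ)) :
    (hooks μ).map (· - (t : ℤ)) + (hooks μ).map (· + (t : ℤ)) +
        ∑ i ∈ Finset.Ico 1 t, (beta t μ i + (t - i)) • {1 * (i : ℤ)} =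
      2 • hooks μ + diffs w + ∑ i ∈ Finset.Ico 1 t, beta t μ i • {-1 * (i : ℤ)} := by
  have hB := isMaya_beads μ
  ext k
  have c1 : ((hooks μ).map (· - (t : ℤ))).count k = (hooks μ).count (k + t) := by
    rw [← Multiset.count_map_eq_count' (· - (t : ℤ)) _ (sub_left_injective) (k + t),
      add_sub_cancel_right]
  have c2 : ((hooks μ).map (· + (t : ℤ))).count k = (hooks μ).count (k - t) := by
    rw [← Multiset.count_map_eq_count' (· + (t : ℤ)) _ (add_left_injective _) (k - t),
      sub_add_cancel]
  rw [Multiset.count_add, Multiset.count_add, Multiset.count_add, Multiset.count_add, c1, c2,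
    Multiset.count_nsmul, count_sum_nsmul_singleton (fun i => beta t μ i + (t - i)) t 1 (by norm_num),
    count_sum_nsmul_singleton (fun i => beta t μ i) t (-1) (by norm_num), count_diffs hw, hr]
  simp only [count_hooks, one_mul, neg_mul]
  have hp := hB.ncard_top_pairs hμ k
  have h0 := gaps_zero (beads μ)
  have ht := hμ.gaps_eq_zero
  rcases lt_trichotomy k 0 with hk | rfl | hk
  · rw [if_neg (show ¬ 0 < k - t by omega), if_neg (show ¬ (0 < k ∧ k < t) by omega),
      if_neg (show ¬ 0 < k by omega)]
    by_cases hkt : 0 < k + t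
    · rw [if_pos hkt, if_neg (by omega), if_pos (by omega), beta_eq (by omega),
        show (t : ℤ) - (-k).toNat = k + t by omega]
      omega
    · rw [if_neg hkt, if_neg (by omega), if_neg (by omega)]
  · simp [ht]
  · rw [if_pos (show 0 < k + t by omega), if_neg (show ¬ (0 < -k ∧ -k < t) by omega),
      if_pos hk, if_pos hk]
    by_cases hkt : k < t
    · -- here `k - t` is negative, and the asymmetry of the gap numbers yields the summand `t - k`
      have hn := hB.gaps_neg (t - k.toNat)
      rw [show -((t - k.toNat : ℕ) : ℤ) = k - t by omega,
        show ((t - k.toNat : ℕ) : ℤ) = t - k by omega] at hn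
      rw [if_neg (by omega), if_pos ⟨hk, hkt⟩, beta_eq (by omega),
        show (t : ℤ) - k.toNat = t - k by omega]
      omega
    · rw [if_neg (show ¬ (0 < k ∧ k < t) by omega)]
      by_cases hkt' : k = t
      · subst hkt'
        rw [sub_self] at hp
        rw [if_neg (by omega)]
        omega
      · rw [if_pos (by omega)]
        omega

theorem sum_sq_diffs {n : ℕ} (w : Fin n → ℤ) :
    ∑ i, ∑ j ∈ Finset.Ioi i, (w i - w j) ^ 2 = n * ∑ i, w i ^ 2 - (∑ i, w i) ^ 2 := by
  induction n with
  | zero => simp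
  | succ n ih =>
    rw [Fin.sum_univ_succ, Fin.sum_Ioi_zero]
    simp only [Fin.sum_Ioi_succ]
    rw [ih fun i => w i.succ, Fin.sum_univ_succ (fun i => w i), Fin.sum_univ_succ fun i => w i ^ 2]
    simp only [sub_sq, Finset.sum_add_distrib, Finset.sum_sub_distrib, ← Finset.mul_sum,
      Finset.sum_const, Finset.card_univ, Fintype.card_fin, nsmul_eq_mul]
    push_cast
    ring

theorem sum_sub_mul_sq (t : ℕ) :
    12 * ∑ i ∈ Finset.Ico 1 t, ((t : ℤ) - i) * (i : ℤ) ^ 2 = t ^ 2 * (t ^ 2 - 1) := by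
  have key : ∀ (T : ℤ) (n : ℕ), 12 * ∑ i ∈ Finset.range n, (T - i) * (i : ℤ) ^ 2 =
      2 * T * (n - 1) * n * (2 * n - 1) - 3 * n ^ 2 * (n - 1) ^ 2 := by
    intro T n
    induction n with
    | zero => simp
    | succ n ih => rw [Finset.sum_range_succ, mul_add, ih]; push_cast; ring
  have h : ∑ i ∈ Finset.Ico 1 t, ((t : ℤ) - i) * (i : ℤ) ^ 2 =
      ∑ i ∈ Finset.range t, ((t : ℤ) - i) * (i : ℤ) ^ 2 := by
    refine Finset.sum_subset (fun i hi => ?_) fun i hi hi' => ?_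
    · exact Finset.mem_range.2 (Finset.mem_Ico.1 hi).2
    · have : i = 0 := by
        have h1 := Finset.mem_range.1 hi
        rw [Finset.mem_Ico] at hi'
        omega
      simp [this]
  rw [h, key]
  ring

/-- Second moments of `hooks_identity`. -/
theorem card_mul {t : ℕ} {μ : YoungDiagram} (hμ : IsFlush t (beads μ))
    {w : Fin t → ℤ} (hw : StrictAnti w) (hr : Set.range w = top t (beads μ)) :
    24 * (t : ℤ) ^ 2 * μ.card =
      12 * (t * ∑ i, w i ^ 2 - (∑ i, w i) ^ 2) - t ^ 2 * (t ^ 2 - 1) := by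
  have h := congrArg (fun m : Multiset ℤ => (m.map fun x => x ^ 2).sum) (hooks_identity hμ hw hr)
  have hsum : ∀ (c : ℕ → ℕ) (e : ℤ), e ^ 2 = 1 →
      ((∑ i ∈ Finset.Ico 1 t, c i • ({e * (i : ℤ)} : Multiset ℤ)).map fun x => x ^ 2).sum =
        ∑ i ∈ Finset.Ico 1 t, (c i : ℤ) * (i : ℤ) ^ 2 := by
    intro c e he
    rw [← Multiset.coe_mapAddMonoidHom, map_sum, Multiset.sum_sum]
    simp [Multiset.map_nsmul, Multiset.sum_nsmul, mul_pow, he]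
  have hd : ((diffs w).map fun x => x ^ 2).sum = ∑ i, ∑ j ∈ Finset.Ioi i, (w i - w j) ^ 2 := by
    simp only [diffs]
    rw [← Multiset.coe_mapAddMonoidHom, map_sum, Multiset.sum_sum]
    simp only [map_sum, Multiset.sum_sum]
    simp
  have hc : Multiset.card (hooks μ) = μ.card := by simp [hooks, hookMultiset, YoungDiagram.card]
  have hm : ((hooks μ).map fun x => (x - (t : ℤ)) ^ 2).sum +
      ((hooks μ).map fun x => (x + (t : ℤ)) ^ 2).sum =
      2 * ((hooks μ).map fun x => x ^ 2).sum + 2 * (t : ℤ) ^ 2 * μ.card := by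
    rw [← hc, ← Multiset.sum_map_add, ← Multiset.sum_map_mul_left,
      Multiset.map_congr rfl (g := fun x => 2 * x ^ 2 + 2 * (t : ℤ) ^ 2) (fun x _ => by ring),
      Multiset.sum_map_add]
    simp
    ring
  simp only [Multiset.map_add, Multiset.sum_add, Multiset.map_map, Function.comp_def,
    Multiset.map_nsmul, Multiset.sum_nsmul] at h
  rw [hm, hd, hsum (fun i => beta t μ i + (t - i)) 1 (by norm_num),
    hsum (fun i => beta t μ i) (-1) (by norm_num), sum_sq_diffs] at h
  have hs : ∑ i ∈ Finset.Ico 1 t, ((beta t μ i + (t - i) : ℕ) : ℤ) * (i : ℤ) ^ 2 =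
      ∑ i ∈ Finset.Ico 1 t, (beta t μ i : ℤ) * (i : ℤ) ^ 2 +
        ∑ i ∈ Finset.Ico 1 t, ((t : ℤ) - i) * (i : ℤ) ^ 2 := by
    rw [← Finset.sum_add_distrib]
    refine Finset.sum_congr rfl fun i hi => ?_
    rw [Nat.cast_add, Nat.cast_sub (Finset.mem_Ico.1 hi).2.le]
    ring
  have h12 := sum_sub_mul_sq t
  rw [hs, nsmul_eq_mul] at h
  push_cast at h
  linarith

/-- The product formula, obtained by applying `τ` to `hooks_identity`. -/
theorem prod_hooks {t : ℕ} {μ : YoungDiagram} (hμ : IsFlush t (beads μ))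
    {w : Fin t → ℤ} (hw : StrictAnti w) (hr : Set.range w = top t (beads μ))
    {F : Type*} [Field F] (τ : ℤ → F) (h1 : ∀ h ∈ hookMultiset μ, τ (h : ℤ) ≠ 0)
    (h2 : ∀ i ∈ Finset.Ico 1 t, τ (i : ℤ) ≠ 0) :
    ((hookMultiset μ).map (fun h : ℕ =>
        τ ((h : ℤ) - (t : ℤ)) * τ ((h : ℤ) + (t : ℤ)) / τ (h : ℤ) ^ 2)).prod =
      (∏ i ∈ Finset.Ico 1 t,
        τ (-(i : ℤ)) ^ beta t μ i / τ (i : ℤ) ^ (beta t μ i + (t - i))) *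
      ∏ i : Fin t, ∏ j ∈ Finset.Ioi i, τ (w i - w j) := by
  have h := congrArg (fun m : Multiset ℤ => (m.map τ).prod) (hooks_identity hμ hw hr)
  have hprod : ∀ (c : ℕ → ℕ) (e : ℤ),
      ((∑ i ∈ Finset.Ico 1 t, c i • ({e * (i : ℤ)} : Multiset ℤ)).map τ).prod =
        ∏ i ∈ Finset.Ico 1 t, τ (e * i) ^ c i := by
    intro c e
    rw [← Multiset.coe_mapAddMonoidHom, map_sum, Multiset.prod_sum]
    simp [Multiset.map_nsmul, Multiset.prod_nsmul]
  have hd : ((diffs w).map τ).prod = ∏ i, ∏ j ∈ Finset.Ioi i, τ (w i - w j) := by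
    simp only [diffs]
    rw [← Multiset.coe_mapAddMonoidHom, map_sum, Multiset.prod_sum]
    simp only [map_sum, Multiset.prod_sum]
    simp
  have hC : ((hookMultiset μ).map fun h : ℕ => τ (h : ℤ)).prod ≠ 0 := by
    refine Multiset.prod_ne_zero fun h0 => ?_
    obtain ⟨n, hn, hn'⟩ := Multiset.mem_map.1 h0
    exact h1 n hn hn'
  have hI : ∏ i ∈ Finset.Ico 1 t, τ (i : ℤ) ^ (beta t μ i + (t - i)) ≠ 0 :=
    Finset.prod_ne_zero_iff.2 fun i hi => pow_ne_zero _ (h2 i hi)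
  simp only [Multiset.map_add, Multiset.prod_add, Multiset.map_map, Function.comp_def,
    Multiset.map_nsmul, Multiset.prod_nsmul] at h
  rw [hd, hprod (fun i => beta t μ i + (t - i)) 1, hprod (fun i => beta t μ i) (-1)] at h
  simp only [hooks, Multiset.map_map, Function.comp_def, one_mul, neg_mul] at h
  rw [Multiset.prod_map_div, Multiset.prod_map_mul, Multiset.prod_map_pow, Finset.prod_div_distrib,
    div_mul_eq_mul_div, div_eq_div_iff (pow_ne_zero _ hC) hI, h]
  ring

/-! ### Codings -/

theorem modEq_shift_iff {t : ℕ} {s : ℚ} {a b : ℤ} :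
    (a : ℚ) + s ≡ b + s [PMOD (t : ℚ)] ↔ (t : ℤ) ∣ a - b := by
  rw [AddCommGroup.modEq_iff_zsmul', ← dvd_neg, neg_sub]
  refine exists_congr fun m => ?_
  rw [add_sub_add_right_eq_sub, zsmul_eq_mul, mul_comm]
  exact_mod_cast Iff.rfl

theorem exists_offset_eq (t : ℕ) : ∃ c : ℤ, offset t = c + ((t : ℚ) + 1) / 2 := by
  rcases Nat.even_or_odd t with h | h
  · obtain ⟨m, rfl⟩ := h
    refine ⟨-m, ?_⟩
    rw [offset, if_neg (Nat.not_odd_iff_even.2 ⟨m, rfl⟩)]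
    push_cast
    ring
  · rw [offset, if_pos h]
    obtain ⟨m, rfl⟩ := h
    refine ⟨-(m + 1), ?_⟩
    push_cast
    ring

theorem strictAnti_shift_iff {t : ℕ} {w : Fin t → ℤ} {s : ℚ} :
    (StrictAnti fun i => (w i : ℚ) + s) ↔ StrictAnti w := by
  simp only [StrictAnti, add_lt_add_iff_right, Int.cast_lt]

/-- `V_t`-codings are, up to a shift by `(t + 1) / 2`, the decreasing sequences of `t` integers
which are pairwise incongruent modulo `t` and have sum `-t (t + 1) / 2`. -/
theorem isVCoding_iff {t : ℕ} (ht : 0 < t) {v : Fin t → ℚ} :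
    IsVCoding t v ↔ ∃ w : Fin t → ℤ, (v = fun i => (w i : ℚ) + ((t : ℚ) + 1) / 2) ∧
      StrictAnti w ∧ (∀ i j, (t : ℤ) ∣ w i - w j → i = j) ∧ 2 * ∑ i, w i = -(t * (t + 1)) := by
  obtain ⟨c, hc⟩ := exists_offset_eq t
  have hoff : ∀ k : ℤ, offset t + k = ((c + k : ℤ) : ℚ) + ((t : ℚ) + 1) / 2 := fun k => by
    rw [hc]
    push_cast
    ring
  have hoffn : ∀ r : ℕ, offset t + r = ((c + r : ℤ) : ℚ) + ((t : ℚ) + 1) / 2 := fun r => by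
    exact_mod_cast hoff r
  have hsum : ∀ w : Fin t → ℤ, ∑ i, ((w i : ℚ) + ((t : ℚ) + 1) / 2) = 0 ↔
      2 * ∑ i, w i = -(t * (t + 1)) := fun w => by
    rw [Finset.sum_add_distrib, Finset.sum_const, Finset.card_univ, Fintype.card_fin, nsmul_eq_mul,
      ← Int.cast_sum, ← @Int.cast_inj ℚ]
    push_cast
    constructor <;> intro h <;> linarith
  constructor
  · rintro ⟨h1, -, h3, h4, h5⟩
    choose k hk using h1
    obtain rfl : v = fun i => ((c + k i : ℤ) : ℚ) + ((t : ℚ) + 1) / 2 :=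
      funext fun i => (hk i).trans (hoff _)
    refine ⟨fun i => c + k i, rfl, strictAnti_shift_iff.1 h5,
      (residues_surj_iff_inj ht _).1 fun x => ?_, (hsum _).1 h4⟩
    have htz : (t : ℤ) ≠ 0 := by omega
    have hr0 := Int.emod_nonneg (x - c) htz
    have hr1 := Int.emod_lt_of_pos (x - c) (show (0 : ℤ) < t by omega)
    obtain ⟨i, hi⟩ := h3 ((x - c) % t).toNat (by omega)
    refine ⟨i, ?_⟩
    rw [hoffn, modEq_shift_iff, Int.toNat_of_nonneg hr0] at hi
    have := hi.sub (Int.dvd_self_sub_emod (x := x - c) (m := t))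
    rwa [show c + k i - (c + (x - c) % t) - (x - c - (x - c) % t) = c + k i - x by ring] at this
  · rintro ⟨w, rfl, h2, h3, h4⟩
    refine ⟨fun i => ⟨w i - c, ?_⟩, fun i => ⟨((w i - c) % t).toNat, ?_, ?_⟩, fun r _ => ?_,
      (hsum w).2 h4, strictAnti_shift_iff.2 h2⟩
    · rw [hoff]
      simp
    · have := Int.emod_lt_of_pos (w i - c) (show (0 : ℤ) < t by omega)
      omega
    · rw [hoffn, modEq_shift_iff, Int.toNat_of_nonneg (Int.emod_nonneg _ (by omega)), ← sub_sub]
      exact Int.dvd_self_sub_emod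
    · obtain ⟨i, hi⟩ := (residues_surj_iff_inj ht w).2 h3 (c + r)
      exact ⟨i, by rw [hoffn, modEq_shift_iff]; exact hi⟩

theorem VSet_eq {t : ℕ} (ht : 0 < t) {μ : YoungDiagram} (hμ : IsFlush t (beads μ)) :
    VSet t μ = (fun x : ℤ => (x : ℚ) + ((t : ℚ) + 1) / 2) '' top t (beads μ) := by
  have hW : WSet t μ = (fun x : ℤ => (x : ℚ) + ((t : ℚ) + 1) / 2) '' beads μ := by
    ext x
    constructor
    · rintro ⟨i, rfl⟩
      exact ⟨_, ⟨i, rfl⟩, by push_cast; ring⟩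
    · rintro ⟨_, ⟨i, rfl⟩, rfl⟩
      exact ⟨i, by push_cast; ring⟩
  rw [VSet, hW]
  ext x
  constructor
  · rintro ⟨⟨a, ha, rfl⟩, hmax⟩
    refine ⟨a, ⟨ha, fun hat => ?_⟩, rfl⟩
    have := hmax _ ⟨_, hat, rfl⟩ (modEq_shift_iff.2 (by simp))
    simp only [add_le_add_iff_right, Int.cast_le] at this
    omega
  · rintro ⟨a, ha, rfl⟩
    refine ⟨⟨a, ha.1, rfl⟩, ?_⟩
    rintro _ ⟨b, hb, rfl⟩ hab
    rw [modEq_shift_iff, ← dvd_neg, neg_sub] at hab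
    simpa using hμ.top_le ha hb hab

theorem range_shift_eq {t : ℕ} (ht : 0 < t) {μ : YoungDiagram} (hμ : IsFlush t (beads μ))
    {w : Fin t → ℤ} (hr : Set.range w = top t (beads μ)) :
    Set.range (fun i => (w i : ℚ) + ((t : ℚ) + 1) / 2) = VSet t μ := by
  rw [VSet_eq ht hμ, ← hr, ← Set.range_comp]
  rfl

/-- The decreasing enumeration of the top beads of a core is a `V_t`-coding. -/
theorem isVCoding_of_range_eq {t : ℕ} (ht : 0 < t) {μ : YoungDiagram} (hμ : IsFlush t (beads μ))
    {w : Fin t → ℤ} (hw : StrictAnti w) (hr : Set.range w = top t (beads μ)) :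
    IsVCoding t fun i => (w i : ℚ) + ((t : ℚ) + 1) / 2 := by
  have hB := isMaya_beads μ
  have hmem : ∀ i, w i ∈ top t (beads μ) := fun i => hr ▸ Set.mem_range_self i
  refine (isVCoding_iff ht).2 ⟨w, rfl, hw, fun i j hij => hw.injective (le_antisymm ?_ ?_), ?_⟩
  · exact hμ.top_le (hmem j) (hmem i).1 (by rwa [← dvd_neg, neg_sub])
  · exact hμ.top_le (hmem i) (hmem j).1 hij
  · have hs := hB.sum_top hμ
    have : (hB.finite_top t).toFinset = Finset.univ.image w := by
      ext x
      simp [← hr]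
    rw [this, Finset.sum_image (fun i _ j _ h => hw.injective h), charge_beads] at hs
    linarith

/-- Every `V_t`-coding comes from a core: the set of the integers below its entries in their classes
modulo `t` has charge `0` because the entries have sum `0`. -/
theorem exists_core_of_isVCoding {t : ℕ} (ht : 0 < t) {v : Fin t → ℚ} (hv : IsVCoding t v) :
    ∃ (μ : YoungDiagram) (w : Fin t → ℤ), IsFlush t (beads μ) ∧ StrictAnti w ∧
      Set.range w = top t (beads μ) ∧ v = fun i => (w i : ℚ) + ((t : ℚ) + 1) / 2 := by
  obtain ⟨w, hvw, hw, hinj, hsum⟩ := (isVCoding_iff ht).1 hv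
  have hB := isMaya_below ((residues_surj_iff_inj ht w).2 hinj)
  have hF := isFlush_below w
  have hT := top_below ht hinj
  have hs := hB.sum_top hF
  have : (hB.finite_top t).toFinset = Finset.univ.image w := by
    ext x
    simp [hT]
  rw [this, Finset.sum_image (fun i _ j _ h => hw.injective h), hsum] at hs
  have hc : charge (below w) = 0 := by
    have h0 : (t : ℤ) * charge (below w) = 0 := by linarith
    exact (mul_eq_zero.1 h0).resolve_left (by omega)
  obtain ⟨μ, hμ⟩ := exists_beads_eq hB hc
  exact ⟨μ, w, hμ ▸ hF, hw, by rw [hμ, hT], hvw⟩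

/-- A flush Maya set, hence a core, is determined by its top elements. -/
theorem eq_of_top_eq {t : ℕ} (ht : 0 < t) {μ ν : YoungDiagram} (hμ : IsFlush t (beads μ))
    (hν : IsFlush t (beads ν)) (h : top t (beads μ) = top t (beads ν)) : μ = ν :=
  beads_injective <| Set.ext fun x => by
    rw [(isMaya_beads μ).mem_iff_top ht hμ, (isMaya_beads ν).mem_iff_top ht hν, h]

end HookCoding

open HookCoding in
theorem theorem1p1 (t : ℕ) (ht : 0 < t) :
    ∃ φ : {μ : YoungDiagram // HookCoding.IsCore t μ} ≃
        {v : Fin t → ℚ // HookCoding.IsVCoding t v},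
      ∀ (μ : {μ : YoungDiagram // HookCoding.IsCore t μ}),
        -- the entries of the coding are the elements of the V-set, in decreasing order
        Set.range (φ μ).1 = HookCoding.VSet t μ.1 ∧
        (μ.1.card : ℚ) =
          1 / (2 * (t : ℚ)) * ∑ i, (φ μ).1 i ^ 2 - ((t : ℚ) ^ 2 - 1) / 24 ∧
        ∀ (F : Type*) [Field F] (τ : ℤ → F),
          -- all denominators are nonzero
          (∀ h ∈ HookCoding.hookMultiset μ.1, τ (h : ℤ) ≠ 0) →
          (∀ i ∈ Finset.Ico 1 t, τ (i : ℤ) ≠ 0) →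
          ((HookCoding.hookMultiset μ.1).map (fun h : ℕ =>
              τ ((h : ℤ) - (t : ℤ)) * τ ((h : ℤ) + (t : ℤ)) / τ (h : ℤ) ^ 2)).prod =
            (∏ i ∈ Finset.Ico 1 t,
              τ (-(i : ℤ)) ^ HookCoding.beta t μ.1 i /
                τ (i : ℤ) ^ (HookCoding.beta t μ.1 i + (t - i))) *
            ∏ i : Fin t, ∏ j ∈ Finset.Ioi i, τ (HookCoding.diff (φ μ).1 i j) := by
  have hF : ∀ μ : {μ : YoungDiagram // IsCore t μ}, IsFlush t (beads μ.1) :=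
    fun μ => (isCore_iff ht μ.1).1 μ.2
  have hex := fun μ : {μ : YoungDiagram // IsCore t μ} =>
    exists_strictAnti_enum ((isMaya_beads μ.1).finite_top t)
      ((isMaya_beads μ.1).ncard_top (hF μ))
  choose w hw hr using hex
  let f : {μ : YoungDiagram // IsCore t μ} → {v : Fin t → ℚ // IsVCoding t v} := fun μ =>
    ⟨fun i => (w μ i : ℚ) + ((t : ℚ) + 1) / 2, isVCoding_of_range_eq ht (hF μ) (hw μ) (hr μ)⟩
  have hf : Function.Bijective f := by
    constructor
    · intro μ ν h
      refine Subtype.ext (eq_of_top_eq ht (hF μ) (hF ν) ?_)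
      have hwe : w μ = w ν := funext fun i => by
        simpa [f] using congrFun (congrArg Subtype.val h) i
      rw [← hr μ, ← hr ν, hwe]
    · rintro ⟨v, hv⟩
      obtain ⟨μ, w', hμ, hw', hr', rfl⟩ := exists_core_of_isVCoding ht hv
      refine ⟨⟨μ, (isCore_iff ht μ).2 hμ⟩, Subtype.ext ?_⟩
      have := ((hw ⟨μ, (isCore_iff ht μ).2 hμ⟩).range_inj hw').1 ((hr _).trans hr'.symm)
      simp only [f, this]
  refine ⟨Equiv.ofBijective f hf, fun μ => ⟨range_shift_eq ht (hF μ) (hr μ), ?_, ?_⟩⟩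
  · have hcard := card_mul (hF μ) (hw μ) (hr μ)
    obtain ⟨w', hwe, -, -, hs⟩ := (isVCoding_iff ht).1 (f μ).2
    obtain rfl : w μ = w' := funext fun i => by simpa [f] using congrFun hwe i
    have e : ∑ i, (f μ).1 i ^ 2 = ∑ i, (w μ i : ℚ) ^ 2 + (t + 1) * ∑ i, (w μ i : ℚ) +
        t * (((t : ℚ) + 1) / 2) ^ 2 := by
      simp only [f, add_sq, Finset.sum_add_distrib, Finset.sum_const, Finset.card_univ,
        Fintype.card_fin, nsmul_eq_mul, Finset.mul_sum]
      congr 2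
      exact Finset.sum_congr rfl fun i _ => by ring
    have hs' : ∑ i, (w μ i : ℚ) = -(t * (t + 1)) / 2 := by
      rw [eq_div_iff two_ne_zero, mul_comm]
      exact_mod_cast hs
    have hcard' : 24 * (t : ℚ) ^ 2 * μ.1.card =
        12 * (t * ∑ i, (w μ i : ℚ) ^ 2 - (∑ i, (w μ i : ℚ)) ^ 2) - t ^ 2 * (t ^ 2 - 1) := by
      exact_mod_cast hcard
    have htq : (t : ℚ) ≠ 0 := by exact_mod_cast ht.ne'
    rw [Equiv.ofBijective_apply, e, hs']
    rw [hs'] at hcard'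
    field_simp
    refine mul_left_cancel₀ htq ?_
    linear_combination 8 * hcard'
  · intro F _ τ h1 h2
    rw [prod_hooks (hF μ) (hw μ) (hr μ) τ h1 h2]
    have hd : ∀ i j, diff (Equiv.ofBijective f hf μ).1 i j = w μ i - w μ j := fun i j => by
      rw [diff, Equiv.ofBijective_apply, show (f μ).1 i - (f μ).1 j = ((w μ i - w μ j : ℤ) : ℚ) by
        simp only [f]; push_cast; ring, Int.floor_intCast]
    simp only [hd]
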